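/- Let $R$ be a commutative Noetherian local ring in which $2$ is invertible, let $I$ be an ideal of $R$, and let $m\ge 2$. Let $e_{i,j}$ denote the $(2m+1)\times(2m+1)$ matrix units, $e_{i,j}(z)=z\,e_{i,j}$, and put $$\tilde\phi_{2m+1}=2e_{1,1}+\sum_{i=1}^{m}\left(e_{2i,2i+1}+e_{2i+1,2i}\right),\qquad \mathrm{O}_{2m+1}(R)=\{\alpha\in \mathrm{GL}_{2m+1}(R):\alpha^{t}\tilde\phi_{2m+1}\alpha=\tilde\phi_{2m+1}\}.$$ Let $\mathrm{SO}_{2m+1}(R,I)$ be the group of all $\alpha\in\mathrm{O}_{2m+1}(R)$ with $\det\alpha=1$ and $\alpha\equiv \mathrm{Id}$ modulo $I$. For $1\le i\le m$ and $z\in R$ put $$F_i^1(z)=\mathrm{Id}+e_{1,2i+1}(z)-e_{2i,1}(2z)-e_{2i,2i+1}(z^2),\qquad F_i^2(z)=\mathrm{Id}+e_{1,2i}(z)-e_{2i+1,1}(2z)-e_{2i+1,2i}(z^2).$$ Let $\mathrm{EO}_{2m+1}(R)$ be the group generated by all $F_i^1(z),F_i^2(z)$ with $1\le i\le m$ and $z\in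 R$, let $\mathrm{EO}_{2m+1}(I)$ be its subgroup generated by those with $z\in I$, and let $\mathrm{EO}_{2m+1}(R,I)$ be the normal closure of $\mathrm{EO}_{2m+1}(I)$ in $\mathrm{EO}_{2m+1}(R)$. Then $\alpha^2\in \mathrm{EO}_{2m+1}(R,I)$ for every $\alpha\in\mathrm{SO}_{2m+1}(R,I)$. Consequently, $\mathrm{EO}_{2m+1}(R,I)$ being a normal subgroup of $\mathrm{SO}_{2m+1}(R,I)$, every element of the quotient group $\mathrm{SO}_{2m+1}(R,I)/\mathrm{EO}_{2m+1}(R,I)$ has order dividing $2$. -/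

import Mathlib

namespace OddOrthogonal

open Matrix

section Indices

variable {m : ℕ}

/-- The position `2i` (counting positions and `i` from `1`) among `1, …, 2m+1`; both are
counted from `0` in `Fin`. -/
def evenIdx (i : Fin m) : Fin (2 * m + 1) := ⟨2 * (i : ℕ) + 1, by omega⟩

/-- The position `2i+1` (counting positions and `i` from `1`) among `1, …, 2m+1`; both are
counted from `0` in `Fin`. -/
def oddIdx (i : Fin m) : Fin (2 * m + 1) := ⟨2 * (i : ℕ) + 2, by omega⟩

theorem evenIdx_ne_zero (i : Fin m) : evenIdx i ≠ 0 := by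
  simp [evenIdx, Fin.ext_iff]

theorem oddIdx_ne_zero (i : Fin m) : oddIdx i ≠ 0 := by
  simp [oddIdx, Fin.ext_iff]

theorem evenIdx_ne_oddIdx (i : Fin m) : evenIdx i ≠ oddIdx i := by
  simp [evenIdx, oddIdx, Fin.ext_iff]

end Indices

section Orthogonal

variable (m : ℕ) {R : Type*} [CommRing R]

/-- The symmetric matrix `2 ⊥ [[0,1],[1,0]] ⊥ ⋯ ⊥ [[0,1],[1,0]]` of size `2m+1`. -/
def form (R : Type*) [CommRing R] : Matrix (Fin (2 * m + 1)) (Fin (2 * m + 1)) R :=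
  single 0 0 2 +
    ∑ i : Fin m, (single (evenIdx i) (oddIdx i) 1 + single (oddIdx i) (evenIdx i) 1)

/-- The orthogonal group `O_{2m+1}(R)` of the form above. -/
def O (R : Type*) [CommRing R] : Subgroup (GL (Fin (2 * m + 1)) R) where
  carrier := {α | (α : Matrix (Fin (2 * m + 1)) (Fin (2 * m + 1)) R)ᵀ * form m R *
    (α : Matrix (Fin (2 * m + 1)) (Fin (2 * m + 1)) R) = form m R}
  one_mem' := by simp
  mul_mem' := by
    intro a b ha hb
    change _ = _ at ha hb
    change _ = _
    rw [Units.val_mul, transpose_mul]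
    calc _ = b.valᵀ * (a.valᵀ * form m R * a.val) * b.val := by simp only [Matrix.mul_assoc]
      _ = _ := by rw [ha, hb]
  inv_mem' := by
    intro a ha
    change _ = _ at ha
    change _ = _
    have h1 : a.val * (a⁻¹).val = 1 := Units.mul_inv a
    have h2 : (a⁻¹).valᵀ * a.valᵀ = 1 := by rw [← transpose_mul, h1, transpose_one]
    calc _ = (a⁻¹).valᵀ * (a.valᵀ * form m R * a.val) * (a⁻¹).val := by rw [ha]
      _ = ((a⁻¹).valᵀ * a.valᵀ) * form m R * (a.val * (a⁻¹).val) := by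
          simp only [Matrix.mul_assoc]
      _ = form m R := by rw [h1, h2, Matrix.one_mul, Matrix.mul_one]

/-- The relative orthogonal group `O_{2m+1}(R, I)`: the elements of `O_{2m+1}(R)` that become
the identity under entrywise reduction modulo `I`. -/
def ORel (I : Ideal R) : Subgroup (GL (Fin (2 * m + 1)) R) :=
  O m R ⊓ (GeneralLinearGroup.map (n := Fin (2 * m + 1)) (Ideal.Quotient.mk I)).ker

/-- The relative special orthogonal group `SO_{2m+1}(R, I)`: the elements of `O_{2m+1}(R, I)` of
determinant one. -/
def SORel (I : Ideal R) : Subgroup (GL (Fin (2 * m + 1)) R) :=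
  ORel m I ⊓ (GeneralLinearGroup.det (n := Fin (2 * m + 1)) (R := R)).ker

end Orthogonal

section Elementary

variable {m : ℕ} {R : Type*} [CommRing R]

/-- The matrix `1 + e_{1,b}(z) - e_{a,1}(2z) - e_{a,b}(z²)` (the first position is `0`). -/
def elemMatrix (a b : Fin (2 * m + 1)) (z : R) :
    Matrix (Fin (2 * m + 1)) (Fin (2 * m + 1)) R :=
  1 + single 0 b z - single a 0 (2 * z) - single a b (z ^ 2)

theorem elemMatrix_mul {a b : Fin (2 * m + 1)} (ha : a ≠ 0) (hb : b ≠ 0) (hab : a ≠ b)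
    (z w : R) : elemMatrix a b z * elemMatrix a b w = elemMatrix a b (z + w) := by
  have e1 : (2 : R) * (z + w) = 2 * z + 2 * w := by ring
  have e2 : (z + w) ^ 2 = z ^ 2 + w ^ 2 + 2 * z * w := by ring
  simp only [elemMatrix, mul_add, mul_sub, add_mul, sub_mul, one_mul, mul_one,
    single_mul_single_same, single_mul_single_of_ne _ _ _ _ hb,
    single_mul_single_of_ne _ _ _ _ hab.symm, single_mul_single_of_ne _ _ _ _ ha.symm]
  rw [← mul_add, e1, e2]
  simp only [single_add]
  abel

theorem elemMatrix_zero (a b : Fin (2 * m + 1)) : elemMatrix a b (0 : R) = 1 := by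
  simp [elemMatrix]

/-- `elemMatrix a b z` as an invertible matrix. -/
def elem (a b : Fin (2 * m + 1)) (ha : a ≠ 0) (hb : b ≠ 0) (hab : a ≠ b) (z : R) :
    GL (Fin (2 * m + 1)) R where
  val := elemMatrix a b z
  inv := elemMatrix a b (-z)
  val_inv := by rw [elemMatrix_mul ha hb hab, add_neg_cancel, elemMatrix_zero]
  inv_val := by rw [elemMatrix_mul ha hb hab, neg_add_cancel, elemMatrix_zero]

/-- `F_i^1(z) = 1 + e_{1,2i+1}(z) - e_{2i,1}(2z) - e_{2i,2i+1}(z²)`. -/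
def F1 (i : Fin m) (z : R) : GL (Fin (2 * m + 1)) R :=
  elem (evenIdx i) (oddIdx i) (evenIdx_ne_zero i) (oddIdx_ne_zero i) (evenIdx_ne_oddIdx i) z

/-- `F_i^2(z) = 1 + e_{1,2i}(z) - e_{2i+1,1}(2z) - e_{2i+1,2i}(z²)`. -/
def F2 (i : Fin m) (z : R) : GL (Fin (2 * m + 1)) R :=
  elem (oddIdx i) (evenIdx i) (oddIdx_ne_zero i) (evenIdx_ne_zero i) (evenIdx_ne_oddIdx i).symm z

variable (m)

/-- `EO_{2m+1}(I)`: the group generated by `F_i^1(z)`, `F_i^2(z)` for `z ∈ I`. -/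
def EOIdeal (I : Ideal R) : Subgroup (GL (Fin (2 * m + 1)) R) :=
  Subgroup.closure {g | ∃ i : Fin m, ∃ z ∈ I, g = F1 i z ∨ g = F2 i z}

/-- The odd elementary orthogonal group `EO_{2m+1}(R)`: the group generated by all `F_i^1(z)`,
`F_i^2(z)` with `z ∈ R`. -/
def EO (R : Type*) [CommRing R] : Subgroup (GL (Fin (2 * m + 1)) R) :=
  Subgroup.closure {g | ∃ i : Fin m, ∃ z : R, g = F1 i z ∨ g = F2 i z}

/-- The relative elementary orthogonal group `EO_{2m+1}(R, I)`: the normal closure of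
`EO_{2m+1}(I)` in `EO_{2m+1}(R)`, as a group of invertible matrices. -/
def EORel (I : Ideal R) : Subgroup (GL (Fin (2 * m + 1)) R) :=
  (Subgroup.normalClosure
    (((EOIdeal m I).subgroupOf (EO m R) : Subgroup (EO m R)) : Set (EO m R))).map (EO m R).subtype

end Elementary

end OddOrthogonal

/-! Modulo `EORel m I`, every element of `SORel m I` is a diagonal matrix `torus p u` with `u ≡ 1`
mod `I`, supported on one fixed hyperbolic pair (`exists_eq_mul_torus`). These diagonal matrices
normalise `EORel m I` (`torus_conj_mem_EORel`), because conjugation only rescales generators. Hence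
`EORel m I` is normal in `SORel m I`, and it remains to square `torus p u`.

With at least two hyperbolic pairs, `torus p u * torus q u⁻¹` is elementary for `p`, `q` in
different pairs (`torus_mul_torus_inv_mem`). Since `torus (bar p) u = torus p u⁻¹`, using this for
`(p, q)` and for `(q, bar p)` shows that `torus p u ^ 2` is elementary (`torus_sq_mem`).

The diagonal form comes from column reduction, one hyperbolic pair at a time (`exists_fix_pair`).
Locality provides a unit pivot, and a Siegel transformation clears the rest of an isotropic column.
Commutators of generators supply the Siegel transformations needed (`exists_isSiegel`). A matrix
fixing all hyperbolic pairs is then the identity, by orthogonality and the determinant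
(`eq_one_of_fix`). -/

namespace OddOrthogonal

open Matrix

/-! ### The bilinear form and its pairing of coordinates. -/

section Bilinear

variable {m : ℕ} {R : Type*} [CommRing R]

/-- The involution of the positions exchanging `evenIdx i` and `oddIdx i` and fixing `0`. -/
def bar (r : Fin (2 * m + 1)) : Fin (2 * m + 1) :=
  ⟨if (r : ℕ) = 0 then 0 else if (r : ℕ) % 2 = 1 then r + 1 else r - 1, by
    have := r.isLt
    split_ifs <;> omega⟩

@[simp] theorem bar_zero : bar (0 : Fin (2 * m + 1)) = 0 := by
  simp [bar]

@[simp] theorem bar_evenIdx (i : Fin m) : bar (evenIdx i) = oddIdx i := by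
  apply Fin.ext
  change (if 2 * (i : ℕ) + 1 = 0 then 0 else if (2 * (i : ℕ) + 1) % 2 = 1 then _ else _) = _
  rw [if_neg (by omega), if_pos (by omega)]
  rfl

@[simp] theorem bar_oddIdx (i : Fin m) : bar (oddIdx i) = evenIdx i := by
  apply Fin.ext
  change (if 2 * (i : ℕ) + 2 = 0 then 0 else if (2 * (i : ℕ) + 2) % 2 = 1 then _ else _) = _
  rw [if_neg (by omega), if_neg (by omega)]
  rfl

theorem eq_evenIdx_or_eq_oddIdx {r : Fin (2 * m + 1)} (hr : r ≠ 0) :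
    (∃ i, r = evenIdx i) ∨ ∃ i, r = oddIdx i := by
  have h0 : (r : ℕ) ≠ 0 := fun h => hr (Fin.ext h)
  have := r.isLt
  rcases Nat.mod_two_eq_zero_or_one r with h | h
  · exact Or.inr ⟨⟨(r : ℕ) / 2 - 1, by omega⟩, Fin.ext (by simp only [oddIdx]; omega)⟩
  · exact Or.inl ⟨⟨(r : ℕ) / 2, by omega⟩, Fin.ext (by simp only [evenIdx]; omega)⟩

@[simp] theorem bar_bar (r : Fin (2 * m + 1)) : bar (bar r) = r := by
  by_cases hr : r = 0
  · simp [hr]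
  · rcases eq_evenIdx_or_eq_oddIdx hr with ⟨i, rfl⟩ | ⟨i, rfl⟩ <;> simp

theorem bar_eq_iff {r s : Fin (2 * m + 1)} : bar r = s ↔ r = bar s :=
  ⟨fun h => by rw [← h, bar_bar], fun h => by rw [h, bar_bar]⟩

theorem bar_ne_zero {r : Fin (2 * m + 1)} (hr : r ≠ 0) : bar r ≠ 0 := by
  rw [Ne, bar_eq_iff, bar_zero]
  exact hr

theorem bar_ne_self {r : Fin (2 * m + 1)} (hr : r ≠ 0) : bar r ≠ r := by
  rcases eq_evenIdx_or_eq_oddIdx hr with ⟨i, rfl⟩ | ⟨i, rfl⟩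
  · simpa using (evenIdx_ne_oddIdx i).symm
  · simpa using evenIdx_ne_oddIdx i

theorem evenIdx_inj {i j : Fin m} : evenIdx i = evenIdx j ↔ i = j := by
  simp [evenIdx, Fin.ext_iff]

theorem oddIdx_inj {i j : Fin m} : oddIdx i = oddIdx j ↔ i = j := by
  simp [oddIdx, Fin.ext_iff]

theorem evenIdx_ne_oddIdx' (i j : Fin m) : evenIdx i ≠ oddIdx j := by
  simp only [evenIdx, oddIdx, Ne, Fin.ext_iff]
  omega

theorem form_apply (r s : Fin (2 * m + 1)) :
    form m R r s = if s = bar r then (if r = 0 then 2 else 1) else 0 := by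
  have h1 := fun i : Fin m => (evenIdx_ne_zero i).symm
  have h2 := fun i : Fin m => (oddIdx_ne_zero i).symm
  have h3 := fun i j : Fin m => (evenIdx_ne_oddIdx' i j).symm
  simp only [form, Matrix.add_apply, Matrix.sum_apply, single_apply]
  by_cases hr : r = 0
  · subst hr
    simp [evenIdx_ne_zero, oddIdx_ne_zero, eq_comm]
  rcases eq_evenIdx_or_eq_oddIdx hr with ⟨i, rfl⟩ | ⟨i, rfl⟩
  · simp [evenIdx_ne_zero, h1, evenIdx_inj, h3, ite_and, eq_comm]
  · simp [oddIdx_ne_zero, h2, oddIdx_inj, evenIdx_ne_oddIdx', ite_and, eq_comm]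

/-- The symmetric bilinear form given by the matrix `form m R`. -/
noncomputable def bil : LinearMap.BilinForm R (Fin (2 * m + 1) → R) :=
  Matrix.toBilin' (form m R)

/-- The standard basis vector at the position `r`. -/
def bas (r : Fin (2 * m + 1)) : Fin (2 * m + 1) → R := Pi.single r 1

theorem bas_self (r : Fin (2 * m + 1)) : (bas r : Fin (2 * m + 1) → R) r = 1 := by simp [bas]

theorem bas_ne {r s : Fin (2 * m + 1)} (h : s ≠ r) : (bas r : Fin (2 * m + 1) → R) s = 0 := by
  simp [bas, h]

theorem bil_bas (r : Fin (2 * m + 1)) (x : Fin (2 * m + 1) → R) :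
    bil (bas r) x = (if r = 0 then 2 else 1) * x (bar r) := by
  rw [bil, Matrix.toBilin'_apply', bas, single_one_dotProduct]
  simp [Matrix.mulVec, dotProduct, form_apply]

theorem bil_bas_zero (x : Fin (2 * m + 1) → R) : bil (bas 0) x = 2 * x 0 := by
  simp [bil_bas]

theorem bil_bas_of_ne_zero {r : Fin (2 * m + 1)} (hr : r ≠ 0) (x : Fin (2 * m + 1) → R) :
    bil (bas r) x = x (bar r) := by
  simp [bil_bas, hr]

theorem form_transpose : (form m R)ᵀ = form m R := by
  ext r s
  rw [transpose_apply, form_apply, form_apply]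
  by_cases h : r = bar s
  · subst h
    by_cases hs : s = 0
    · simp [hs]
    · simp [hs, bar_ne_zero hs]
  · rw [if_neg h, if_neg (fun h' => h (bar_eq_iff.1 h'.symm))]

theorem bil_comm (x y : Fin (2 * m + 1) → R) : bil x y = bil y x := by
  rw [bil, Matrix.toBilin'_apply', Matrix.toBilin'_apply', dotProduct_mulVec, dotProduct_comm,
    ← mulVec_transpose, form_transpose]

theorem mem_O_iff {g : GL (Fin (2 * m + 1)) R} :
    g ∈ O m R ↔ ∀ x y, bil (g.val *ᵥ x) (g.val *ᵥ y) = bil x y := by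
  change g.valᵀ * form m R * g.val = form m R ↔ _
  rw [← (Matrix.toBilin' (n := Fin (2 * m + 1)) (R₁ := R)).injective.eq_iff]
  rw [LinearMap.ext_iff₂]
  refine forall₂_congr fun x y => ?_
  simp only [bil, Matrix.toBilin'_apply', ← mulVec_mulVec, dotProduct_mulVec, vecMul_transpose]

theorem GL_ext {g h : GL (Fin (2 * m + 1)) R} (H : ∀ x, g.val *ᵥ x = h.val *ᵥ x) : g = h := by
  apply Units.ext
  exact Matrix.mulVec_injective (funext H)

theorem GL_mul_mulVec (g h : GL (Fin (2 * m + 1)) R) (x : Fin (2 * m + 1) → R) :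
    (g * h).val *ᵥ x = g.val *ᵥ (h.val *ᵥ x) := by
  rw [Units.val_mul, mulVec_mulVec]

theorem GL_inv_mulVec_self (g : GL (Fin (2 * m + 1)) R) (x : Fin (2 * m + 1) → R) :
    (g⁻¹).val *ᵥ (g.val *ᵥ x) = x := by
  rw [← GL_mul_mulVec, inv_mul_cancel, Units.val_one, one_mulVec]

theorem GL_self_inv_mulVec (g : GL (Fin (2 * m + 1)) R) (x : Fin (2 * m + 1) → R) :
    g.val *ᵥ ((g⁻¹).val *ᵥ x) = x := by
  rw [← GL_mul_mulVec, mul_inv_cancel, Units.val_one, one_mulVec]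

end Bilinear

/-! ### Siegel transformations. -/

section Siegel

variable {m : ℕ} {R : Type*} [CommRing R] [Invertible (2 : R)]

/-- `g` is the Siegel transformation attached to the isotropic vector `e` and to `w ∈ e^⊥`. -/
def IsSiegel (g : GL (Fin (2 * m + 1)) R) (e w : Fin (2 * m + 1) → R) : Prop :=
  ∀ x, g.val *ᵥ x = x + bil e x • w - (bil w x + ⅟2 * bil w w * bil e x) • e

theorem IsSiegel.one (e : Fin (2 * m + 1) → R) :
    IsSiegel (1 : GL (Fin (2 * m + 1)) R) e 0 := by
  intro x
  simp

/-- For fixed `e` the transformation is additive in the vector: the composite produces the cross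
term `bil v w`, which is exactly the polarisation of `⅟2 * bil w w`. -/
theorem IsSiegel.mul {g h : GL (Fin (2 * m + 1)) R} {e v w : Fin (2 * m + 1) → R}
    (hg : IsSiegel g e v) (hh : IsSiegel h e w) (he : bil e e = 0) (hv : bil e v = 0)
    (hw : bil e w = 0) : IsSiegel (g * h) e (v + w) := by
  intro x
  have hv' : bil v e = 0 := by rw [bil_comm, hv]
  have h2 : (2 : R) * ⅟2 = 1 := mul_invOf_self 2
  have hc : bil w v = bil v w := bil_comm w v
  rw [GL_mul_mulVec, hh, hg]
  simp only [map_add, map_sub, map_smul, LinearMap.add_apply, smul_eq_mul, he, hv', hw, hc]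
  match_scalars
  · ring
  · ring
  · linear_combination (bil v w * bil e x) * h2
  · ring

theorem IsSiegel.conj {g s : GL (Fin (2 * m + 1)) R} {e v : Fin (2 * m + 1) → R}
    (hg : IsSiegel g e v) (hs : s ∈ O m R) :
    IsSiegel (s * g * s⁻¹) (s.val *ᵥ e) (s.val *ᵥ v) := by
  intro x
  have hs' := mem_O_iff.1 hs
  obtain ⟨y, rfl⟩ : ∃ y, s.val *ᵥ y = x := ⟨_, GL_self_inv_mulVec s x⟩
  rw [GL_mul_mulVec, GL_mul_mulVec, GL_inv_mulVec_self, hg, hs', hs', hs', mulVec_sub, mulVec_add,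
    mulVec_smul, mulVec_smul]

theorem IsSiegel.mem_O {g : GL (Fin (2 * m + 1)) R} {e v : Fin (2 * m + 1) → R}
    (hg : IsSiegel g e v) (he : bil e e = 0) (hv : bil e v = 0) : g ∈ O m R := by
  have hv' : bil v e = 0 := by rw [bil_comm, hv]
  have h2 : (2 : R) * ⅟2 = 1 := mul_invOf_self 2
  rw [mem_O_iff]
  intro x y
  rw [hg, hg]
  simp only [map_add, map_sub, map_smul, LinearMap.add_apply, LinearMap.sub_apply,
    LinearMap.smul_apply, smul_eq_mul, he, hv, hv', bil_comm x e, bil_comm x v]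
  linear_combination -(bil v v * bil e x * bil e y) * h2

theorem isSiegel_elem {r : Fin (2 * m + 1)} (hr : r ≠ 0) (z : R) :
    IsSiegel (elem r (bar r) hr (bar_ne_zero hr) (bar_ne_self hr).symm z) (bas r) (z • bas 0) := by
  intro x
  have h2 : (2 : R) * ⅟2 = 1 := mul_invOf_self 2
  change elemMatrix r (bar r) z *ᵥ x = _
  simp only [elemMatrix, sub_mulVec, add_mulVec, one_mulVec, single_mulVec, map_smul,
    LinearMap.smul_apply, bil_bas_zero, bil_bas_of_ne_zero hr, smul_eq_mul, bas_self]
  have key (i : Fin (2 * m + 1)) (c : R) :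
      Function.update (0 : Fin (2 * m + 1) → R) i c = c • (bas i : Fin (2 * m + 1) → R) := by
    ext j
    by_cases h : j = i
    · subst h; simp [bas]
    · simp [bas, h]
  simp only [key]
  match_scalars
  · ring
  · ring
  · linear_combination (z ^ 2 * x (bar r)) * h2

end Siegel

/-! ### Diagonal elements and membership in the relative groups. -/

section Torus

variable {m : ℕ} {R : Type*} [CommRing R]

/-- The diagonal matrix with `u` at the position `p`, `u⁻¹` at the position `bar p` and `1` at
all others (for `p ≠ 0`). -/
def torus (p : Fin (2 * m + 1)) (u : Rˣ) : GL (Fin (2 * m + 1)) R :=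
  Units.map (diagonalRingHom (Fin (2 * m + 1)) R).toMonoidHom
    (MulEquiv.piUnits.symm (Pi.mulSingle p u * Pi.mulSingle (bar p) u⁻¹))

theorem torus_val (p : Fin (2 * m + 1)) (u : Rˣ) : (torus p u).val =
    diagonal fun r => (((Pi.mulSingle p u * Pi.mulSingle (bar p) u⁻¹ : _ → Rˣ) r : Rˣ) : R) :=
  rfl

theorem torus_mulVec {p : Fin (2 * m + 1)} (hp : p ≠ 0) (u : Rˣ) (x : Fin (2 * m + 1) → R) :
    (torus p u).val *ᵥ x = x + (((u : R) - 1) * x p) • bas p +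
      ((((u⁻¹ : Rˣ) : R) - 1) * x (bar p)) • bas (bar p) := by
  have hpb := bar_ne_self hp
  ext r
  rw [torus_val, mulVec_diagonal]
  by_cases h : r = p
  · subst h
    simp [bas, hpb.symm]
    ring
  · by_cases h' : r = bar p
    · subst h'
      simp [bas, hpb]
      ring
    · simp [bas, h, h']

theorem bil_bas_self {r : Fin (2 * m + 1)} (hr : r ≠ 0) :
    bil (bas r) (bas r : Fin (2 * m + 1) → R) = 0 := by
  rw [bil_bas_of_ne_zero hr, bas_ne (bar_ne_self hr)]

theorem bil_bas_smul_bas_zero {r : Fin (2 * m + 1)} (hr : r ≠ 0) (z : R) :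
    bil (bas r) (z • bas 0 : Fin (2 * m + 1) → R) = 0 := by
  rw [map_smul, bil_bas_of_ne_zero hr, bas_ne (bar_ne_zero hr), smul_zero]

theorem torus_mulVec_bas_self {p : Fin (2 * m + 1)} (hp : p ≠ 0) (u : Rˣ) :
    (torus p u).val *ᵥ bas p = (u : R) • bas p := by
  rw [torus_mulVec hp, bas_self, bas_ne (bar_ne_self hp)]
  module

theorem torus_mulVec_bas_bar {p : Fin (2 * m + 1)} (hp : p ≠ 0) (u : Rˣ) :
    (torus p u).val *ᵥ bas (bar p) = ((u⁻¹ : Rˣ) : R) • bas (bar p) := by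
  rw [torus_mulVec hp, bas_self, bas_ne (bar_ne_self hp).symm]
  module

theorem torus_mulVec_bas_of_ne {p r : Fin (2 * m + 1)} (hp : p ≠ 0) (h : r ≠ p) (h' : r ≠ bar p)
    (u : Rˣ) : (torus p u).val *ᵥ bas r = bas r := by
  rw [torus_mulVec hp, bas_ne h.symm, bas_ne h'.symm]
  module

theorem torus_mul (p : Fin (2 * m + 1)) (u v : Rˣ) :
    torus p (u * v) = torus p u * torus p v := by
  unfold torus
  rw [← map_mul, ← map_mul, mul_inv, Pi.mulSingle_mul, Pi.mulSingle_mul, mul_mul_mul_comm]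

theorem torus_one (p : Fin (2 * m + 1)) : torus p (1 : Rˣ) = 1 := by
  simp [torus]

theorem torus_inv (p : Fin (2 * m + 1)) (u : Rˣ) : (torus p u)⁻¹ = torus p u⁻¹ := by
  rw [inv_eq_iff_mul_eq_one, ← torus_mul, mul_inv_cancel, torus_one]

theorem torus_bar (p : Fin (2 * m + 1)) (u : Rˣ) : torus (bar p) u = torus p u⁻¹ := by
  simp [torus, mul_comm]

theorem torus_mem_O {p : Fin (2 * m + 1)} (hp : p ≠ 0) (u : Rˣ) : torus p u ∈ O m R := by
  rw [mem_O_iff]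
  intro x y
  have hu : (u : R) * ((u⁻¹ : Rˣ) : R) = 1 := u.mul_inv
  rw [torus_mulVec hp, torus_mulVec hp]
  simp only [map_add, map_smul, LinearMap.add_apply, LinearMap.smul_apply, smul_eq_mul,
    bil_comm x (bas _), bil_bas_of_ne_zero hp, bil_bas_of_ne_zero (bar_ne_zero hp), bar_bar,
    bas_self, bas_ne (bar_ne_self hp), bas_ne (bar_ne_self hp).symm]
  linear_combination (x p * y (bar p) + y p * x (bar p)) * hu

theorem det_torus {p : Fin (2 * m + 1)} (u : Rˣ) :
    GeneralLinearGroup.det (torus p u) = 1 := by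
  apply Units.ext
  rw [GeneralLinearGroup.val_det_apply, torus_val, det_diagonal, ← Units.coe_prod]
  simp [Finset.prod_mul_distrib]

theorem mem_ker_map_iff {I : Ideal R} {g : GL (Fin (2 * m + 1)) R} :
    g ∈ (GeneralLinearGroup.map (n := Fin (2 * m + 1)) (Ideal.Quotient.mk I)).ker ↔
      ∀ x r, (g.val *ᵥ x) r - x r ∈ I := by
  rw [MonoidHom.mem_ker]
  constructor
  · intro h x r
    have h1 : g.val.map (Ideal.Quotient.mk I) = 1 := congrArg Units.val h
    rw [← Ideal.Quotient.eq, RingHom.map_mulVec]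
    simp [h1]
  · intro h
    apply Units.ext
    ext r s
    have := h (Pi.single s 1) r
    rw [← Ideal.Quotient.eq] at this
    simp only [mulVec_single_one, col_apply] at this
    change Ideal.Quotient.mk I (g.val r s) = _
    rw [this, Units.val_one, one_apply, Pi.single_apply]
    split_ifs <;> simp

theorem mem_SORel_iff {I : Ideal R} {g : GL (Fin (2 * m + 1)) R} :
    g ∈ SORel m I ↔ (∀ x y, bil (g.val *ᵥ x) (g.val *ᵥ y) = bil x y) ∧
      (∀ x r, (g.val *ᵥ x) r - x r ∈ I) ∧ GeneralLinearGroup.det g = 1 := by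
  rw [← mem_O_iff, ← mem_ker_map_iff, ← and_assoc]
  rfl

theorem mulVec_bil_of_mem_SORel {g : GL (Fin (2 * m + 1)) R} (hg : g ∈ SORel m I)
    (x y : Fin (2 * m + 1) → R) : bil (g.val *ᵥ x) (g.val *ᵥ y) = bil x y :=
  (mem_SORel_iff.1 hg).1 x y

theorem torus_mem_SORel {I : Ideal R} {p : Fin (2 * m + 1)} (hp : p ≠ 0) {u : Rˣ}
    (hu : (u : R) - 1 ∈ I) : torus p u ∈ SORel m I := by
  refine mem_SORel_iff.2 ⟨mem_O_iff.1 (torus_mem_O hp u), fun x r => ?_, det_torus u⟩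
  have hu' : ((u⁻¹ : Rˣ) : R) - 1 ∈ I := by
    have : ((u⁻¹ : Rˣ) : R) - 1 = -((u⁻¹ : Rˣ) : R) * (u - 1) := by
      linear_combination u.inv_mul
    rw [this]
    exact I.mul_mem_left _ hu
  rw [torus_mulVec hp, add_assoc, Pi.add_apply, add_sub_cancel_left]
  exact I.add_mem (I.mul_mem_right _ (I.mul_mem_right _ hu))
    (I.mul_mem_right _ (I.mul_mem_right _ hu'))

end Torus

/-! ### Generators and closure properties of the elementary groups. -/

section Generators

variable {m : ℕ} {R : Type*} [CommRing R]

/-- The generator of `EO m R` sending `bas 0` to `bas 0 - 2 * z * bas r`. -/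
def gen (r : Fin (2 * m + 1)) (hr : r ≠ 0) (z : R) : GL (Fin (2 * m + 1)) R :=
  elem r (bar r) hr (bar_ne_zero hr) (bar_ne_self hr).symm z

theorem gen_evenIdx (i : Fin m) (z : R) : gen (evenIdx i) (evenIdx_ne_zero i) z = F1 i z := by
  apply Units.ext
  change elemMatrix _ _ _ = elemMatrix _ _ _
  rw [bar_evenIdx]

theorem gen_oddIdx (i : Fin m) (z : R) : gen (oddIdx i) (oddIdx_ne_zero i) z = F2 i z := by
  apply Units.ext
  change elemMatrix _ _ _ = elemMatrix _ _ _
  rw [bar_oddIdx]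

theorem gen_mem_EOIdeal {I : Ideal R} {r : Fin (2 * m + 1)} (hr : r ≠ 0) {z : R} (hz : z ∈ I) :
    gen r hr z ∈ EOIdeal m I := by
  apply Subgroup.subset_closure
  rcases eq_evenIdx_or_eq_oddIdx hr with ⟨i, rfl⟩ | ⟨i, rfl⟩
  · exact ⟨i, z, hz, Or.inl (gen_evenIdx i z)⟩
  · exact ⟨i, z, hz, Or.inr (gen_oddIdx i z)⟩

theorem EOIdeal_le {I : Ideal R} {N : Subgroup (GL (Fin (2 * m + 1)) R)}
    (h : ∀ r hr, ∀ z ∈ I, gen r hr z ∈ N) : EOIdeal m I ≤ N := by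
  rw [EOIdeal, Subgroup.closure_le]
  rintro g ⟨i, z, hz, rfl | rfl⟩
  · rw [← gen_evenIdx]
    exact h _ _ z hz
  · rw [← gen_oddIdx]
    exact h _ _ z hz

theorem EO_eq_EOIdeal_top : EO m R = EOIdeal m (⊤ : Ideal R) := by
  simp [EO, EOIdeal]

theorem EOIdeal_le_EO (I : Ideal R) : EOIdeal m I ≤ EO m R := by
  rw [EO_eq_EOIdeal_top]
  exact EOIdeal_le fun r hr z _ => gen_mem_EOIdeal hr Submodule.mem_top

theorem EORel_le_EO (I : Ideal R) : EORel m I ≤ EO m R :=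
  Subgroup.map_subtype_le _

theorem EOIdeal_le_EORel (I : Ideal R) : EOIdeal m I ≤ EORel m I := fun g hg =>
  ⟨⟨g, EOIdeal_le_EO I hg⟩, Subgroup.subset_normalClosure hg, rfl⟩

theorem conj_mem_EORel {I : Ideal R} {g s : GL (Fin (2 * m + 1)) R} (hg : g ∈ EORel m I)
    (hs : s ∈ EO m R) : s * g * s⁻¹ ∈ EORel m I := by
  rw [EORel, Subgroup.mem_map] at hg
  obtain ⟨g, hg, rfl⟩ := hg
  have h := Subgroup.mem_map_of_mem (EO m R).subtype
    (Subgroup.normalClosure_normal.conj_mem g hg ⟨s, hs⟩)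
  rwa [map_mul, map_mul, map_inv] at h

theorem EORel_le {I : Ideal R} {N : Subgroup (GL (Fin (2 * m + 1)) R)}
    (h : ∀ r hr, ∀ z ∈ I, gen r hr z ∈ N)
    (hN : ∀ g ∈ N, ∀ s ∈ EO m R, s * g * s⁻¹ ∈ N) : EORel m I ≤ N := by
  have : (N.comap (EO m R).subtype).Normal := ⟨fun g hg s => hN g hg s s.2⟩
  rw [EORel, Subgroup.map_le_iff_le_comap]
  exact Subgroup.normalClosure_le_normal fun g hg => EOIdeal_le h hg

end Generators

/-! ### Elements of the relative elementary group. -/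

section Relative

variable {m : ℕ} {R : Type*} [CommRing R] [Invertible (2 : R)] {I : Ideal R}

theorem isSiegel_gen {r : Fin (2 * m + 1)} (hr : r ≠ 0) (z : R) :
    IsSiegel (gen r hr z) (bas r) (z • bas 0) :=
  isSiegel_elem hr z

theorem gen_mem_O {r : Fin (2 * m + 1)} (hr : r ≠ 0) (z : R) : gen r hr z ∈ O m R :=
  (isSiegel_gen hr z).mem_O (bil_bas_self hr) (bil_bas_smul_bas_zero hr z)

theorem EO_le_O : EO m R ≤ O m R := by
  rw [EO_eq_EOIdeal_top]
  exact EOIdeal_le fun r hr z _ => gen_mem_O hr z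

/-- The torus scales `bas r` by a unit and fixes `bas 0`, and in a Siegel transformation a scalar
can be moved from the isotropic vector to the other one. The clause for `r = p` serves the
determinant computation in `det_gen`. -/
theorem torus_conj_gen {p r : Fin (2 * m + 1)} (hp : p ≠ 0) (hr : r ≠ 0) (u : Rˣ) :
    ∃ v : Rˣ, (r = p → v = u) ∧
      ∀ z : R, torus p u * gen r hr z * (torus p u)⁻¹ = gen r hr (v * z) := by
  obtain ⟨v, hv, hvr⟩ : ∃ v : Rˣ, (r = p → v = u) ∧
      (torus p u).val *ᵥ bas r = (v : R) • bas r := by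
    by_cases h : r = p
    · subst h
      exact ⟨u, fun _ => rfl, torus_mulVec_bas_self hp u⟩
    · by_cases h' : r = bar p
      · subst h'
        exact ⟨u⁻¹, fun h'' => absurd h'' h, torus_mulVec_bas_bar hp u⟩
      · exact ⟨1, fun h'' => absurd h'' h, by
          rw [torus_mulVec_bas_of_ne hp h h', Units.val_one, one_smul]⟩
  refine ⟨v, hv, fun z => ?_⟩
  have h1 := (isSiegel_gen hr z).conj (torus_mem_O hp u)
  rw [hvr, mulVec_smul, torus_mulVec_bas_of_ne hp hp.symm (bar_ne_zero hp).symm] at h1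
  refine GL_ext fun x => ?_
  rw [h1, isSiegel_gen]
  simp only [map_smul, LinearMap.smul_apply, smul_eq_mul]
  module

/-- Conjugation by `torus r 2` turns the generator into its own square, so its determinant `d`
satisfies `d = d * d`. -/
theorem det_gen {r : Fin (2 * m + 1)} (hr : r ≠ 0) (z : R) :
    GeneralLinearGroup.det (gen r hr z) = 1 := by
  obtain ⟨v, hv, h⟩ := torus_conj_gen hr hr (unitOfInvertible (2 : R))
  have h1 := h z
  have h2 : gen r hr (v * z) = gen r hr z * gen r hr z := by
    apply Units.ext
    change elemMatrix _ _ _ = elemMatrix _ _ _ * elemMatrix _ _ _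
    rw [elemMatrix_mul hr (bar_ne_zero hr) (bar_ne_self hr).symm, hv rfl, val_unitOfInvertible]
    exact congrArg _ (two_mul z)
  rw [h2] at h1
  have h3 := congrArg GeneralLinearGroup.det h1
  simpa using h3

theorem torus_conj_mem_EO {p : Fin (2 * m + 1)} (hp : p ≠ 0) (u : Rˣ)
    {g : GL (Fin (2 * m + 1)) R} (hg : g ∈ EO m R) :
    torus p u * g * (torus p u)⁻¹ ∈ EO m R := by
  have : EO m R ≤ (EO m R).comap (MulAut.conj (torus p u)).toMonoidHom := by
    conv_lhs => rw [EO_eq_EOIdeal_top]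
    refine EOIdeal_le fun r hr z _ => ?_
    obtain ⟨v, -, h⟩ := torus_conj_gen hp hr u
    change torus p u * gen r hr z * (torus p u)⁻¹ ∈ EO m R
    rw [h, EO_eq_EOIdeal_top]
    exact gen_mem_EOIdeal hr Submodule.mem_top
  exact this hg

theorem torus_conj_mem_EORel {p : Fin (2 * m + 1)} (hp : p ≠ 0) (u : Rˣ)
    {g : GL (Fin (2 * m + 1)) R} (hg : g ∈ EORel m I) :
    torus p u * g * (torus p u)⁻¹ ∈ EORel m I := by
  have : EORel m I ≤ (EORel m I).comap (MulAut.conj (torus p u)).toMonoidHom := by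
    refine EORel_le (fun r hr z hz => ?_) fun g hg s hs => ?_
    · obtain ⟨v, -, h⟩ := torus_conj_gen hp hr u
      change torus p u * gen r hr z * (torus p u)⁻¹ ∈ EORel m I
      rw [h]
      exact EOIdeal_le_EORel I (gen_mem_EOIdeal hr (I.mul_mem_left _ hz))
    · have h1 := conj_mem_EORel hg (torus_conj_mem_EO hp u hs)
      change torus p u * (s * g * s⁻¹) * (torus p u)⁻¹ ∈ EORel m I
      change torus p u * s * (torus p u)⁻¹ * (torus p u * g * (torus p u)⁻¹) *
        (torus p u * s * (torus p u)⁻¹)⁻¹ ∈ EORel m I at h1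
      convert h1 using 1
      group
  exact this hg

theorem EORel_le_SORel : EORel m I ≤ SORel m I := by
  refine EORel_le (fun r hr z hz => ?_) fun g hg s hs => ?_
  · refine mem_SORel_iff.2 ⟨mem_O_iff.1 (gen_mem_O hr z), fun x j => ?_, det_gen hr z⟩
    rw [isSiegel_gen hr z, add_sub_assoc, Pi.add_apply, add_sub_cancel_left]
    simp only [map_smul, LinearMap.smul_apply, smul_eq_mul, Pi.sub_apply, Pi.smul_apply]
    refine I.sub_mem (I.mul_mem_left _ (I.mul_mem_right _ hz)) (I.mul_mem_right _ ?_)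
    refine I.add_mem (I.mul_mem_right _ hz) (I.mul_mem_right _ (I.mul_mem_left _ ?_))
    exact I.mul_mem_right _ hz
  · obtain ⟨⟨h1, h2⟩, h3⟩ := hg
    refine ⟨⟨?_, (MonoidHom.normal_ker _).conj_mem g h2 s⟩,
      (MonoidHom.normal_ker _).conj_mem g h3 s⟩
    exact (O m R).mul_mem ((O m R).mul_mem (EO_le_O hs) h1) ((O m R).inv_mem (EO_le_O hs))

theorem exists_isSiegel_bas {r q : Fin (2 * m + 1)} (hr : r ≠ 0) (hq : q ≠ bar r) {z : R}
    (hz : z ∈ I) : ∃ g ∈ EORel m I, IsSiegel g (bas r) (z • bas q) := by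
  have hgen (z : R) (hz : z ∈ I) : gen r hr z ∈ EORel m I :=
    EOIdeal_le_EORel I (gen_mem_EOIdeal hr hz)
  by_cases hq0 : q = 0
  · subst hq0
    exact ⟨_, hgen z hz, isSiegel_gen hr z⟩
  by_cases hqr : q = r
  · subst hqr
    -- A multiple of the isotropic vector itself gives the identity.
    refine ⟨1, one_mem _, fun x => ?_⟩
    simp only [map_smul, LinearMap.smul_apply, smul_eq_mul, bil_bas_self hr, Units.val_one,
      one_mulVec]
    module
  -- With parameter `⅟2`, the generator `s` at `q` fixes `bas r` and sends `bas 0` to `bas 0 - bas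
  -- q`. So `s * gen r (-z) * s⁻¹ * gen r z` is the Siegel transformation at `bas r` with vector `-z
  -- (bas 0 - bas q) + z bas 0 = z bas q`.
  have hsO := gen_mem_O hq0 (⅟2 : R)
  have hg := isSiegel_gen hr (-z)
  have h1 : (gen q hq0 (⅟2 : R)).val *ᵥ bas r = bas r := by
    rw [isSiegel_gen hq0 ⅟2, bil_bas_of_ne_zero hq0,
      bas_ne (fun h => hq (bar_eq_iff.1 h)), map_smul, LinearMap.smul_apply, bil_bas_zero,
      bas_ne hr.symm]
    module
  have h2 : (gen q hq0 (⅟2 : R)).val *ᵥ bas 0 = bas 0 - bas q := by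
    rw [isSiegel_gen hq0 ⅟2, bil_bas_of_ne_zero hq0, bas_ne (bar_ne_zero hq0), map_smul,
      LinearMap.smul_apply, bil_bas_zero, bas_self, smul_eq_mul, mul_one, invOf_mul_self]
    module
  have h3 := hg.conj hsO
  rw [h1, mulVec_smul, h2] at h3
  have h4 := h3.mul (isSiegel_gen hr z) (bil_bas_self hr) (by
    rw [map_smul, bil_bas_of_ne_zero hr, Pi.sub_apply, bas_ne (bar_ne_zero hr),
      bas_ne hq.symm, sub_zero, smul_zero]) (bil_bas_smul_bas_zero hr z)
  refine ⟨_, mul_mem (conj_mem_EORel (s := gen q hq0 ⅟2) (hgen (-z) (I.neg_mem hz)) ?_)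
    (hgen z hz), ?_⟩
  · rw [EO_eq_EOIdeal_top]
    exact gen_mem_EOIdeal hq0 Submodule.mem_top
  · convert h4 using 1
    module

theorem exists_isSiegel {r : Fin (2 * m + 1)} (hr : r ≠ 0) {w : Fin (2 * m + 1) → R}
    (hw : ∀ q, w q ∈ I) (hwr : w (bar r) = 0) : ∃ g ∈ EORel m I, IsSiegel g (bas r) w := by
  have key (t : Finset (Fin (2 * m + 1))) :
      ∃ g ∈ EORel m I, IsSiegel g (bas r) (∑ q ∈ t, w q • bas q) := by
    induction t using Finset.induction_on with
    | empty => exact ⟨1, one_mem _, by simpa using IsSiegel.one (bas r)⟩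
    | insert a t ha ih =>
      obtain ⟨g, hg, hg'⟩ := ih
      by_cases har : a = bar r
      · refine ⟨g, hg, ?_⟩
        rwa [Finset.sum_insert ha, har, hwr, zero_smul, zero_add]
      · obtain ⟨h, hh, hh'⟩ := exists_isSiegel_bas hr har (hw a)
        refine ⟨h * g, mul_mem hh hg, ?_⟩
        rw [Finset.sum_insert ha]
        refine hh'.mul hg' (bil_bas_self hr) ?_ ?_
        · rw [map_smul, bil_bas_of_ne_zero hr, bas_ne (Ne.symm har), smul_zero]
        · rw [map_sum]
          refine Finset.sum_eq_zero fun q _ => ?_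
          rw [map_smul, bil_bas_of_ne_zero hr]
          by_cases h : bar r = q
          · rw [← h, hwr, zero_smul]
          · rw [bas_ne h, smul_zero]
  obtain ⟨g, hg, hg'⟩ := key Finset.univ
  refine ⟨g, hg, ?_⟩
  convert hg'
  ext j
  simp [bas, Pi.single_apply]

/-- The product `torus p u * torus q u⁻¹` lies in the relative elementary group. -/
theorem torus_mul_torus_inv_mem {p q : Fin (2 * m + 1)} (hp : p ≠ 0) (hq : q ≠ 0) (hpq : q ≠ p)
    (hpq' : q ≠ bar p) {u : Rˣ} (hu : (u : R) - 1 ∈ I) :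
    torus p u * torus q u⁻¹ ∈ EORel m I := by
  have hp' := bar_ne_zero hp
  have hq' := bar_ne_zero hq
  have d1 : bar q ≠ p := fun h => hpq' (bar_eq_iff.1 h)
  have d2 : bar q ≠ bar p := fun h => hpq (by rw [bar_eq_iff.1 h, bar_bar])
  have d3 := bar_ne_self hp
  have d4 := bar_ne_self hq
  have A (J : Ideal R) (z : R) (hz : z ∈ J) : ∃ g ∈ EORel m J, ∀ x,
      g.val *ᵥ x = x - (z * x (bar p)) • bas (bar q) + (z * x q) • bas p := by
    obtain ⟨g, hg, hg'⟩ := exists_isSiegel_bas (q := bar q) hp d2 (J.neg_mem hz)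
    refine ⟨g, hg, fun x => ?_⟩
    rw [hg']
    simp only [map_smul, LinearMap.smul_apply, smul_eq_mul, bil_bas_self hq',
      bil_bas_of_ne_zero hp, bil_bas_of_ne_zero hq', bar_bar]
    module
  have B (J : Ideal R) (z : R) (hz : z ∈ J) : ∃ g ∈ EORel m J, ∀ x,
      g.val *ᵥ x = x - (z * x (bar q)) • bas (bar p) + (z * x p) • bas q := by
    obtain ⟨g, hg, hg'⟩ := exists_isSiegel_bas (q := bar p) hq d2.symm (J.neg_mem hz)
    refine ⟨g, hg, fun x => ?_⟩
    rw [hg']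
    simp only [map_smul, LinearMap.smul_apply, smul_eq_mul, bil_bas_self hp',
      bil_bas_of_ne_zero hq, bil_bas_of_ne_zero hp', bar_bar]
    module
  -- On the span of `bas p`, `bas q`, with `U`, `L` the upper and lower unitriangular matrices, the
  -- identity used is `diag(u, u⁻¹) = L(-u⁻¹(u-1)) · U(1) L(u-1) U(1)⁻¹ · U(u⁻¹(u-1))`. The only
  -- parameter outside `I` sits in the conjugating factor, so the product stays in the relative
  -- group.
  obtain ⟨a, ha, ha'⟩ := A ⊤ 1 Submodule.mem_top
  obtain ⟨b, hb, hb'⟩ := B I _ hu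
  obtain ⟨c, hc, hc'⟩ := B I _ (I.mul_mem_left (-((u⁻¹ : Rˣ) : R)) hu)
  obtain ⟨d, hd, hd'⟩ := A I _ (I.mul_mem_left (((u⁻¹ : Rˣ) : R)) hu)
  have ha'' (x : Fin (2 * m + 1) → R) :
      (a⁻¹).val *ᵥ x = x + x (bar p) • bas (bar q) - x q • bas p := by
    rw [← (Matrix.mulVec_injective_of_isUnit (a.isUnit)).eq_iff, GL_self_inv_mulVec, ha']
    simp only [Pi.add_apply, Pi.sub_apply, Pi.smul_apply, smul_eq_mul, bas_ne d2.symm,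
      bas_ne d3, bas_ne d4.symm, bas_ne hpq]
    module
  have hmem := mul_mem (mul_mem hc (conj_mem_EORel hb (EORel_le_EO _ ha))) hd
  convert hmem using 1
  have hval : ((u⁻¹ : Rˣ) : R) * u = 1 := u.inv_mul
  refine GL_ext fun x => ?_
  simp only [GL_mul_mulVec, ha', ha'', hb', hc', hd', torus_mulVec hp, torus_mulVec hq,
    Pi.add_apply, Pi.sub_apply, Pi.smul_apply, smul_eq_mul, bas_self, bas_ne hpq,
    bas_ne hpq.symm, bas_ne hpq', bas_ne hpq'.symm, bas_ne d1, bas_ne d1.symm, bas_ne d2,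
    bas_ne d2.symm, bas_ne d3, bas_ne d3.symm, bas_ne d4, bas_ne d4.symm, inv_inv,
    mul_zero, add_zero, sub_zero, mul_one]
  generalize ((u⁻¹ : Rˣ) : R) = v at hval ⊢
  generalize (u : R) = u at hval ⊢
  match_scalars <;> grind

end Relative

/-! ### Unit pivots over a local ring, and the end point of the reduction. -/

theorem isUnit_sub_of_not_isUnit {R : Type*} [CommRing R] [IsLocalRing R] {a b : R} (ha : ¬IsUnit a) (hb : IsUnit b) :
    IsUnit (a - b) := by
  have h : IsUnit (a + -(a - b)) := by
    have : a + -(a - b) = b := by ring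
    rwa [this]
  rcases IsLocalRing.isUnit_or_isUnit_of_isUnit_add h with h | h
  · exact absurd h ha
  · simpa using h.neg

theorem exists_isUnit_mulVec_bas {m : ℕ} {R : Type*} [CommRing R] [IsLocalRing R] (g : GL (Fin (2 * m + 1)) R)
    (p : Fin (2 * m + 1)) : ∃ r, IsUnit ((g.val *ᵥ bas p) r) := by
  by_contra! h
  have h1 : ((g⁻¹).val *ᵥ (g.val *ᵥ bas p)) p ∈ IsLocalRing.maximalIdeal R := by
    rw [mulVec, dotProduct]
    exact Ideal.sum_mem _ fun r _ => Ideal.mul_mem_left _ _ (h r)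
  rw [GL_inv_mulVec_self, bas_self] at h1
  exact h1 isUnit_one

/-- Pairing the image of `bas 0` with the fixed basis vectors kills all its coordinates but the one
at `0`. The matrix is thus diagonal with one unknown entry, which is the determinant. -/
theorem eq_one_of_fix {m : ℕ} {R : Type*} [CommRing R] {I : Ideal R}
    {α : GL (Fin (2 * m + 1)) R} (hα : α ∈ SORel m I)
    (hfix : ∀ r ≠ 0, α.val *ᵥ bas r = bas r) : α = 1 := by
  have h1 : α.val = diagonal fun r => if r = 0 then α.val 0 0 else 1 := by
    ext r s
    have hrs (s) : α.val r s = (α.val *ᵥ bas s) r := by simp [bas]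
    rw [diagonal_apply]
    by_cases hs : s = 0
    · subst hs
      by_cases hr : r = 0
      · simp [hr]
      · have h := mulVec_bil_of_mem_SORel hα (bas (bar r)) (bas 0)
        have hr' := bar_ne_zero hr
        rw [hfix _ hr', bil_bas_of_ne_zero hr', bil_bas_of_ne_zero hr', bar_bar, bas_ne hr] at h
        rw [hrs, h, if_neg hr]
    · rw [hrs, hfix s hs]
      by_cases hr : r = s
      · subst hr
        simp [hs, bas_self]
      · rw [bas_ne hr, if_neg hr]
  have h2 : α.val.det = 1 := congrArg Units.val (mem_SORel_iff.1 hα).2.2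
  rw [h1, det_diagonal, Finset.prod_ite_eq' Finset.univ 0, if_pos (Finset.mem_univ _)] at h2
  apply Units.ext
  rw [h1, h2, Units.val_one, ← diagonal_one]
  congr 1
  ext r
  simp

/-! ### Column reduction to the torus. -/

section Reduction

variable {m : ℕ} {R : Type*} [CommRing R] [Invertible (2 : R)] {I : Ideal R}

/-- An isotropic vector congruent to a multiple of `bas p` with invertible coefficient is moved
to this multiple by an elementary matrix. -/
theorem exists_mulVec_eq_smul_bas {p : Fin (2 * m + 1)} (hp : p ≠ 0) {v : Fin (2 * m + 1) → R}
    (hv : bil v v = 0) (hunit : IsUnit (v p)) (hI : ∀ r ≠ p, v r ∈ I)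
    {S : Set (Fin (2 * m + 1))} (hS0 : 0 ∉ S) (hpS : p ∉ S) (hpS' : bar p ∉ S)
    (hvS : ∀ r ∈ S, v (bar r) = 0) :
    ∃ g ∈ EORel m I, g.val *ᵥ v = v p • bas p ∧ g.val *ᵥ bas (bar p) = bas (bar p) ∧
      ∀ r ∈ S, g.val *ᵥ bas r = bas r := by
  have hp' := bar_ne_zero hp
  have hpp := bar_ne_self hp
  obtain ⟨a, ha⟩ := hunit
  have hinv : (a : R) * ((a⁻¹ : Rˣ) : R) = 1 := a.mul_inv
  -- `w` is `-a⁻¹` times the part of `v` off the pair `p`, `bar p`. The Siegel transformation at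
  -- `bas (bar p)` adds `a • w` to `v`, which cancels that part.
  obtain ⟨w, hw⟩ : ∃ w : Fin (2 * m + 1) → R, w = (-((a⁻¹ : Rˣ) : R)) •
    (v - (a : R) • bas p - v (bar p) • bas (bar p)) := ⟨_, rfl⟩
  have hwp : w p = 0 := by simp [hw, bas, hpp.symm, ha]
  have hwp' : w (bar p) = 0 := by simp [hw, bas, hpp]
  have hwr (r) (h : r ≠ p) (h' : r ≠ bar p) : w r = -((a⁻¹ : Rˣ) : R) * v r := by
    simp [hw, bas, h, h']
  obtain ⟨g, hg, hgw⟩ := exists_isSiegel (I := I) (w := w) hp' (fun q => by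
    by_cases h : q = p
    · rw [h, hwp]; exact I.zero_mem
    by_cases h' : q = bar p
    · rw [h', hwp']; exact I.zero_mem
    rw [hwr q h h']
    exact I.mul_mem_left _ (hI q h)) (by rw [bar_bar, hwp])
  refine ⟨g, hg, ?_, ?_, fun r hr => ?_⟩
  · have h1 : g.val *ᵥ v = v p • bas p +
        (v (bar p) - (bil w v + ⅟2 * bil w w * v p)) • bas (bar p) := by
      rw [hgw, bil_bas_of_ne_zero hp', bar_bar, ← ha]
      have h2 : (a : R) • w = a • bas p + v (bar p) • bas (bar p) - v := by
        rw [hw, smul_smul, mul_neg, hinv]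
        simp only [Units.smul_def]
        module
      rw [h2]
      simp only [Units.smul_def]
      module
    have h3 := mulVec_bil_of_mem_SORel (EORel_le_SORel hg) v v
    rw [hv, h1] at h3
    generalize v (bar p) - (bil w v + ⅟2 * bil w w * v p) = c at h1 h3
    simp only [map_add, map_smul, LinearMap.add_apply, LinearMap.smul_apply, smul_eq_mul,
      bil_bas_of_ne_zero hp, bil_bas_of_ne_zero hp', bar_bar, bas_self, bas_ne hpp,
      bas_ne hpp.symm] at h3
    -- The image `a • bas p + c • bas (bar p)` is still isotropic, so `2 * a * c = 0`.
    have h4 : c = 0 := by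
      have h2 : (2 : R) * ⅟2 = 1 := mul_invOf_self 2
      rw [← ha] at h3
      linear_combination (⅟2 * ((a⁻¹ : Rˣ) : R)) * h3 - c * h2 - 2 * ⅟2 * c * hinv
    rw [h1, h4, zero_smul, add_zero]
  · rw [hgw, bil_bas_of_ne_zero hp', bar_bar, bas_ne hpp.symm, bil_comm w,
      bil_bas_of_ne_zero hp', bar_bar, hwp]
    module
  · have hr0 : r ≠ 0 := fun h => hS0 (h ▸ hr)
    have hrp : p ≠ r := fun h => hpS (h ▸ hr)
    have hrp' : r ≠ bar p := fun h => hpS' (h ▸ hr)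
    have hwr0 : w (bar r) = 0 := by
      by_cases h : bar r = bar p
      · rw [h, hwp']
      · rw [hwr _ (fun h => hrp' (bar_eq_iff.1 h)) h, hvS r hr, mul_zero]
    rw [hgw, bil_bas_of_ne_zero hp', bar_bar, bas_ne hrp, bil_comm w, bil_bas_of_ne_zero hr0,
      hwr0]
    module

theorem exists_isUnit_mulVec [IsLocalRing R] {p : Fin (2 * m + 1)} (hp : p ≠ 0)
    {v : Fin (2 * m + 1) → R} (hv : ∃ r, IsUnit (v r))
    {S : Set (Fin (2 * m + 1))} (hS0 : 0 ∉ S) (hpS' : bar p ∉ S)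
    (hvS : ∀ r ∈ S, v r = 0) :
    ∃ g ∈ EORel m (⊤ : Ideal R), IsUnit ((g.val *ᵥ v) p) ∧
      ∀ r ∈ S, g.val *ᵥ bas r = bas r := by
  have hp' := bar_ne_zero hp
  have hpp := bar_ne_self hp
  have h2 : IsUnit (2 : R) := isUnit_of_invertible 2
  by_cases hvp : IsUnit (v p)
  · exact ⟨1, one_mem _, by simpa using hvp, fun r _ => by simp⟩
  have hSp (r) (hr : r ∈ S) : (bas r : Fin (2 * m + 1) → R) (bar p) = 0 :=
    bas_ne fun h => hpS' (h ▸ hr)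
  -- The Siegel transformation at `bas p` with vector `t • bas 0` subtracts `2 * t * v 0 + t ^ 2 * v
  -- (bar p)` from the coordinate at `p`. A nonunit minus a unit is a unit.
  by_cases h : ∃ t : R, t ^ 2 = 1 ∧ IsUnit (2 * t * v 0 + v (bar p))
  · obtain ⟨t, ht, hu⟩ := h
    obtain ⟨g, hg, hgw⟩ := exists_isSiegel_bas (I := (⊤ : Ideal R)) (q := 0) (z := t) hp
      hp'.symm Submodule.mem_top
    refine ⟨g, hg, ?_, fun r hr => ?_⟩
    · have h1 : (g.val *ᵥ v) p = v p - (2 * t * v 0 + v (bar p)) := by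
        rw [hgw]
        simp only [map_smul, LinearMap.smul_apply, smul_eq_mul, bil_bas_of_ne_zero hp,
          bil_bas_zero, Pi.sub_apply, Pi.add_apply, Pi.smul_apply, bas_self, bas_ne hp]
        linear_combination (-t ^ 2 * v (bar p)) * invOf_mul_self (2 : R) - v (bar p) * ht
      rw [h1]
      exact isUnit_sub_of_not_isUnit hvp hu
    · rw [hgw, bil_bas_of_ne_zero hp, hSp r hr, map_smul, LinearMap.smul_apply, bil_bas_zero,
        bas_ne (r := r) (s := 0) (fun h => hS0 (h ▸ hr))]
      module
  -- If both `t = 1` and `t = -1` fail, adding the two nonunits shows that `v (bar p)`, and then `v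
  -- 0`, is a nonunit. A unit coordinate `v r` therefore lies in another hyperbolic pair, and the
  -- Siegel transformation with vector `bas (bar r)` subtracts it from `v p`.
  · push Not at h
    have h1 := h 1 (by ring)
    have h3 := h (-1) (by ring)
    have hbar : ¬IsUnit (v (bar p)) := by
      intro hu
      have h4 : IsUnit ((2 * 1 * v 0 + v (bar p)) + (2 * (-1) * v 0 + v (bar p))) := by
        convert h2.mul hu using 1
        ring
      rcases IsLocalRing.isUnit_or_isUnit_of_isUnit_add h4 with h4 | h4
      · exact h1 h4
      · exact h3 h4
    have hzero : ¬IsUnit (v 0) := by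
      intro hu
      have h4 := isUnit_sub_of_not_isUnit hbar (h2.mul hu).neg
      apply h1
      convert h4 using 1
      ring
    obtain ⟨r, hr⟩ := hv
    have hr0 : r ≠ 0 := fun h => hzero (h ▸ hr)
    have hrp : r ≠ p := fun h => hvp (h ▸ hr)
    have hrp' : r ≠ bar p := fun h => hbar (h ▸ hr)
    have hr0' := bar_ne_zero hr0
    obtain ⟨g, hg, hgw⟩ := exists_isSiegel_bas (I := (⊤ : Ideal R)) (q := bar r) (z := 1) hp
      (fun h => hrp (by rw [bar_eq_iff.1 h, bar_bar])) Submodule.mem_top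
    refine ⟨g, hg, ?_, fun s hs => ?_⟩
    · have h1 : (g.val *ᵥ v) p = v p - v r := by
        rw [hgw]
        simp only [one_smul, smul_eq_mul, bil_bas_of_ne_zero hp,
          bil_bas_of_ne_zero hr0', bar_bar, Pi.sub_apply, Pi.add_apply, Pi.smul_apply, bas_self,
          bas_ne (fun h => hrp' (bar_eq_iff.1 h.symm) : p ≠ bar r), bas_ne (bar_ne_self hr0).symm]
        ring
      rw [h1]
      exact isUnit_sub_of_not_isUnit hvp hr
    · rw [hgw, one_smul, bil_bas_of_ne_zero hp, hSp s hs, bil_bas_of_ne_zero hr0', bar_bar,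
        bas_ne (fun h => not_isUnit_zero (hvS s hs ▸ h ▸ hr))]
      module

/-- An element of `SORel m I` fixing some basis vectors is moved by elementary matrices and a
torus element to one which fixes an additional hyperbolic pair. -/
theorem exists_fix_pair [IsLocalRing R] {α : GL (Fin (2 * m + 1)) R} (hα : α ∈ SORel m I)
    {p : Fin (2 * m + 1)} (hp : p ≠ 0) {S : Set (Fin (2 * m + 1))} (hS0 : 0 ∉ S)
    (hSbar : ∀ r ∈ S, bar r ∈ S) (hpS : p ∉ S) (hfix : ∀ r ∈ S, α.val *ᵥ bas r = bas r) :
    ∃ ε ∈ EORel m I, ∃ u : Rˣ, (u : R) - 1 ∈ I ∧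
      ∀ r, (r = p ∨ r = bar p ∨ r ∈ S) → (torus p u * ε * α).val *ᵥ bas r = bas r := by
  have hp' := bar_ne_zero hp
  have hpp := bar_ne_self hp
  have hpS' : bar p ∉ S := fun h => hpS (by simpa using hSbar _ h)
  have orth {β : GL (Fin (2 * m + 1)) R} (hβ : β ∈ SORel m I)
      (hβS : ∀ r ∈ S, β.val *ᵥ bas r = bas r) {q} (hq : q ∉ S) (r) (hr : r ∈ S) :
      (β.val *ᵥ bas q) (bar r) = 0 := by
    have hr0 : r ≠ 0 := fun h => hS0 (h ▸ hr)
    have h := mulVec_bil_of_mem_SORel hβ (bas r) (bas q)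
    rw [hβS r hr, bil_bas_of_ne_zero hr0, bil_bas_of_ne_zero hr0,
      bas_ne (r := q) (s := bar r) (fun h => hq (h ▸ hSbar r hr))] at h
    exact h
  have cong {β : GL (Fin (2 * m + 1)) R} (hβ : β ∈ SORel m I) {q r} (hr : r ≠ q) :
      (β.val *ᵥ bas q) r ∈ I := by
    have h := (mem_SORel_iff.1 hβ).2.1 (bas q) r
    rwa [bas_ne hr, sub_zero] at h
  have comp {β g : GL (Fin (2 * m + 1)) R} (hg : ∀ r ∈ S, g.val *ᵥ bas r = bas r)
      (hβ : ∀ r ∈ S, β.val *ᵥ bas r = bas r) (r) (hr : r ∈ S) :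
      (g * β).val *ᵥ bas r = bas r := by
    rw [GL_mul_mulVec, hβ r hr, hg r hr]
  obtain ⟨g₁, hg₁, hu₁, hS₁⟩ : ∃ g ∈ EORel m I, IsUnit ((g.val *ᵥ (α.val *ᵥ bas p)) p) ∧
      ∀ r ∈ S, g.val *ᵥ bas r = bas r := by
    -- For proper `I` the coordinate at `p` is already `1` modulo the maximal ideal. Only for `I =
    -- ⊤` must a unit be created, and then all elementary matrices are allowed.
    by_cases hI : I = ⊤
    · subst hI
      refine exists_isUnit_mulVec hp (exists_isUnit_mulVec_bas α p) hS0 hpS' fun r hr => ?_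
      simpa using orth hα hfix hpS _ (hSbar r hr)
    · refine ⟨1, one_mem _, ?_, fun r _ => by simp⟩
      have h := IsLocalRing.le_maximalIdeal hI ((mem_SORel_iff.1 hα).2.1 (bas p) p)
      rw [bas_self] at h
      rw [Units.val_one, one_mulVec]
      by_contra hn
      exact (IsLocalRing.maximalIdeal R).one_notMem
        (by simpa using (IsLocalRing.maximalIdeal R).sub_mem hn h)
  have hα₁ : g₁ * α ∈ SORel m I := mul_mem (EORel_le_SORel hg₁) hα
  have hαS₁ := comp hS₁ hfix
  rw [← GL_mul_mulVec] at hu₁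
  obtain ⟨g₂, hg₂, he₂, -, hS₂⟩ := exists_mulVec_eq_smul_bas (I := I) hp
    (v := (g₁ * α).val *ᵥ bas p)
    (by rw [mulVec_bil_of_mem_SORel hα₁, bil_bas_self hp]) hu₁ (fun r hr => cong hα₁ hr)
    hS0 hpS hpS' (orth hα₁ hαS₁ hpS)
  have hα₂ : g₂ * (g₁ * α) ∈ SORel m I := mul_mem (EORel_le_SORel hg₂) hα₁
  have hαS₂ := comp hS₂ hαS₁
  obtain ⟨a, ha⟩ := hu₁
  rw [← ha, ← GL_mul_mulVec] at he₂
  have haI : (a : R) - 1 ∈ I := by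
    have h := (mem_SORel_iff.1 hα₂).2.1 (bas p) p
    rw [he₂] at h
    simpa [bas_self] using h
  have hbar₂ : (a : R) * ((g₂ * (g₁ * α)).val *ᵥ bas (bar p)) (bar p) = 1 := by
    have h := mulVec_bil_of_mem_SORel hα₂ (bas p) (bas (bar p))
    rw [he₂, map_smul, LinearMap.smul_apply, bil_bas_of_ne_zero hp, bil_bas_of_ne_zero hp,
      bas_self] at h
    exact h
  have hbar₂' : ((g₂ * (g₁ * α)).val *ᵥ bas (bar p)) (bar p) = ((a⁻¹ : Rˣ) : R) :=
    (Units.inv_eq_of_mul_eq_one_right hbar₂).symm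
  -- `g₃` also fixes `bas (bar (bar p)) = bas p`, so clearing the second column does not undo the
  -- first.
  obtain ⟨g₃, hg₃, he₃, hp₃, hS₃⟩ := exists_mulVec_eq_smul_bas (I := I) hp'
    (v := (g₂ * (g₁ * α)).val *ᵥ bas (bar p))
    (by rw [mulVec_bil_of_mem_SORel hα₂, bil_bas_self hp']) (by rw [hbar₂']; exact a⁻¹.isUnit)
    (fun r hr => cong hα₂ hr) hS0 hpS' (by rwa [bar_bar]) (orth hα₂ hαS₂ hpS')
  rw [bar_bar] at hp₃
  rw [hbar₂', ← GL_mul_mulVec] at he₃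
  have hαS₃ := comp hS₃ hαS₂
  have hep₃ : (g₃ * (g₂ * (g₁ * α))).val *ᵥ bas p = (a : R) • bas p := by
    rw [GL_mul_mulVec, he₂, mulVec_smul, hp₃]
  refine ⟨g₃ * (g₂ * g₁), mul_mem hg₃ (mul_mem hg₂ hg₁), a⁻¹, ?_, fun r hr => ?_⟩
  · have : ((a⁻¹ : Rˣ) : R) - 1 = -((a⁻¹ : Rˣ) : R) * (a - 1) := by
      linear_combination a.inv_mul
    rw [this]
    exact I.mul_mem_left _ haI
  · rw [show torus p a⁻¹ * (g₃ * (g₂ * g₁)) * α = torus p a⁻¹ * (g₃ * (g₂ * (g₁ * α))) by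
      simp only [mul_assoc], GL_mul_mulVec]
    rcases hr with rfl | rfl | hr
    · rw [hep₃, mulVec_smul, torus_mulVec_bas_self hp, smul_smul, Units.mul_inv, one_smul]
    · rw [he₃, mulVec_smul, torus_mulVec_bas_bar hp, inv_inv, smul_smul, Units.inv_mul, one_smul]
    · rw [hαS₃ r hr, torus_mulVec_bas_of_ne hp (fun h => hpS (h ▸ hr)) (fun h => hpS' (h ▸ hr))]

theorem torus_mem_mul_torus {p q : Fin (2 * m + 1)} (hp : p ≠ 0) (hq : q ≠ 0) (hq' : q ≠ bar p)
    {u : Rˣ} (hu : (u : R) - 1 ∈ I) : ∃ ε ∈ EORel m I, torus q u = ε * torus p u := by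
  by_cases hpq : p = q
  · subst hpq
    exact ⟨1, one_mem _, by rw [one_mul]⟩
  · refine ⟨_, torus_mul_torus_inv_mem hq hp hpq (fun h => hq' (bar_eq_iff.1 h.symm)) hu, ?_⟩
    rw [mul_assoc, ← torus_mul, inv_mul_cancel, torus_one, mul_one]

theorem torus_sq_mem (hm : 2 ≤ m) {p : Fin (2 * m + 1)} (hp : p ≠ 0) {u : Rˣ}
    (hu : (u : R) - 1 ∈ I) : torus p u ^ 2 ∈ EORel m I := by
  obtain ⟨q, hq, hqp, hqp'⟩ : ∃ q : Fin (2 * m + 1), q ≠ 0 ∧ q ≠ p ∧ q ≠ bar p := by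
    have hcard : ({0, p, bar p} : Finset (Fin (2 * m + 1))).card <
        (Finset.univ : Finset (Fin (2 * m + 1))).card := by
      refine Finset.card_le_three.trans_lt ?_
      rw [Finset.card_univ, Fintype.card_fin]
      omega
    obtain ⟨q, -, hq⟩ := Finset.exists_mem_notMem_of_card_lt_card hcard
    simp only [Finset.mem_insert, Finset.mem_singleton, not_or] at hq
    exact ⟨q, hq⟩
  have h1 := torus_mul_torus_inv_mem hp hq hqp hqp' hu
  have h2 := torus_mul_torus_inv_mem hq (bar_ne_zero hp) hqp'.symm
    (fun h => hqp (by rw [← bar_bar q, ← h, bar_bar])) hu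
  have h3 := mul_mem h1 h2
  rwa [torus_bar, inv_inv, mul_assoc, ← mul_assoc (torus q u⁻¹), ← torus_mul, inv_mul_cancel,
    torus_one, one_mul, ← pow_two] at h3

theorem exists_eq_mul_torus [IsLocalRing R] (hm : 0 < m) {α : GL (Fin (2 * m + 1)) R}
    (hα : α ∈ SORel m I) : ∃ ε ∈ EORel m I, ∃ u : Rˣ, (u : R) - 1 ∈ I ∧
      α = ε * torus (evenIdx ⟨0, hm⟩) u := by
  -- `k` counts the hyperbolic pairs already fixed, at positions `1, …, 2k` counted from `0`; `j`
  -- counts those left.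
  have key (j : ℕ) : ∀ k, k + j = m → ∀ α ∈ SORel m I,
      (∀ r : Fin (2 * m + 1), r ≠ 0 → (r : ℕ) ≤ 2 * k → α.val *ᵥ bas r = bas r) →
      ∃ ε ∈ EORel m I, ∃ u : Rˣ, (u : R) - 1 ∈ I ∧ α = ε * torus (evenIdx ⟨0, hm⟩) u := by
    induction j with
    | zero =>
      intro k hk α hα hfix
      refine ⟨1, one_mem _, 1, by simp, ?_⟩
      rw [torus_one, one_mul]
      exact eq_one_of_fix hα fun r hr => hfix r hr (by omega)
    | succ j ih =>
      intro k hk α hα hfix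
      have hp := evenIdx_ne_zero (⟨k, by omega⟩ : Fin m)
      obtain ⟨ε, hε, u, hu, hfix'⟩ := exists_fix_pair hα hp
        (S := {r | r ≠ 0 ∧ (r : ℕ) ≤ 2 * k}) (fun h => h.1 rfl) (fun r hr => by
          refine ⟨bar_ne_zero hr.1, ?_⟩
          obtain ⟨hr0, hr⟩ := hr
          rcases eq_evenIdx_or_eq_oddIdx hr0 with ⟨i, rfl⟩ | ⟨i, rfl⟩
          · rw [bar_evenIdx]
            simp only [evenIdx, oddIdx] at hr ⊢
            omega
          · rw [bar_oddIdx]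
            simp only [evenIdx, oddIdx] at hr ⊢
            omega) (fun h => by
          have := h.2
          simp only [evenIdx] at this
          omega) (fun r hr => hfix r hr.1 hr.2)
      obtain ⟨δ, hδ, v, hv, h⟩ := ih (k + 1) (by omega) _
        (mul_mem (mul_mem (torus_mem_SORel hp hu) (EORel_le_SORel hε)) hα) (fun r hr0 hr => by
          apply hfix'
          by_cases h1 : (r : ℕ) ≤ 2 * k
          · exact Or.inr (Or.inr ⟨hr0, h1⟩)
          by_cases h2 : (r : ℕ) = 2 * k + 1
          · exact Or.inl (Fin.ext h2)
          · right; left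
            rw [bar_evenIdx]
            apply Fin.ext
            simp only [oddIdx]
            omega)
      have hp0 := evenIdx_ne_zero (⟨0, hm⟩ : Fin m)
      obtain ⟨η, hη, h'⟩ := torus_mem_mul_torus hp0 hp
        -- The torus element of the current pair is replaced by the one at the first pair, up to the
        -- elementary factor `η`. Conjugation then moves it to the right of the elementary factors.
        (by rw [bar_evenIdx]; exact evenIdx_ne_oddIdx' _ _) hu
      have hc := torus_conj_mem_EORel hp0 u⁻¹ (mul_mem (inv_mem hη) hδ)
      rw [← torus_inv, inv_inv] at hc
      refine ⟨_, mul_mem (inv_mem hε) hc, u⁻¹ * v, ?_, ?_⟩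
      · have : ((u⁻¹ * v : Rˣ) : R) - 1 = ((u⁻¹ : Rˣ) : R) * ((v - 1) - (u - 1)) := by
          rw [Units.val_mul]
          linear_combination u.inv_mul
        rw [this]
        exact I.mul_mem_left _ (I.sub_mem hv hu)
      · rw [torus_mul, ← torus_inv]
        rw [h'] at h
        calc α = ε⁻¹ * (η * torus (evenIdx ⟨0, hm⟩) u)⁻¹ *
              (η * torus (evenIdx ⟨0, hm⟩) u * ε * α) := by group
          _ = _ := by rw [h]; group
  exact key m 0 (by omega) α hα fun r hr h => absurd (Fin.ext (by simpa using h)) hr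

end Reduction

end OddOrthogonal

theorem mainTheorem10 {R : Type*} [CommRing R] [IsNoetherianRing R] [IsLocalRing R]
    (h2 : IsUnit (2 : R)) (I : Ideal R) (m : ℕ) (hm : 2 ≤ m) :
    (∀ α ∈ OddOrthogonal.SORel m I, α ^ 2 ∈ OddOrthogonal.EORel m I) ∧
    OddOrthogonal.EORel m I ≤ OddOrthogonal.SORel m I ∧
    ∃ _ : ((OddOrthogonal.EORel m I).subgroupOf (OddOrthogonal.SORel m I)).Normal,
      ∀ x : OddOrthogonal.SORel m I ⧸
          (OddOrthogonal.EORel m I).subgroupOf (OddOrthogonal.SORel m I),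
        orderOf x ∣ 2 := by
  open OddOrthogonal in
  have hinv : Invertible (2 : R) := h2.invertible
  have hm0 : 0 < m := by omega
  have hp := evenIdx_ne_zero (⟨0, hm0⟩ : Fin m)
  have hsq : ∀ α ∈ SORel m I, α ^ 2 ∈ EORel m I := by
    intro α hα
    obtain ⟨ε, hε, u, hu, rfl⟩ := exists_eq_mul_torus hm0 hα
    -- With `t` the torus factor, `(ε t)² = ε · (t ε t⁻¹) · t²`.
    have h := mul_mem (mul_mem hε (torus_conj_mem_EORel hp u hε)) (torus_sq_mem hm hp hu)
    convert h using 1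
    rw [pow_two, pow_two]
    group
  have hN : ((EORel m I).subgroupOf (SORel m I)).Normal := by
    refine ⟨fun g hg s => ?_⟩
    obtain ⟨ε, hε, u, -, hs⟩ := exists_eq_mul_torus hm0 s.2
    have h := mul_mem (mul_mem hε (torus_conj_mem_EORel hp u (Subgroup.mem_subgroupOf.1 hg)))
      (inv_mem hε)
    rw [Subgroup.mem_subgroupOf]
    convert h using 1
    rw [Subgroup.coe_mul, Subgroup.coe_mul, Subgroup.coe_inv, hs]
    group
  refine ⟨hsq, EORel_le_SORel, hN, fun x => ?_⟩
  apply orderOf_dvd_of_pow_eq_one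
  induction x using QuotientGroup.induction_on with
  | H s =>
    rw [← QuotientGroup.mk_pow, QuotientGroup.eq_one_iff, Subgroup.mem_subgroupOf]
    exact hsq s s.2
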